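/- Let $N$ be a positive integer, let $\Lambda=\{w\in\mathbb R^N:\ \sum_i w^i=1,\ w^i\ge 0\}$, and let $\delta_\Lambda$ be the function equal to $0$ on $\Lambda$ and $+\infty$ elsewhere. Let $F:\mathbb R^N\to\mathbb R\cup\{+\infty\}$ be a storage fee function, i.e. a proper, closed (lower semicontinuous), convex function with effective domain $\operatorname{dom}F\subset\Lambda$. Suppose that $F$ splits: $F(w)=\sum_{i=1}^N f_i(w^i)+\delta_\Lambda(w)$, where each $f_i:\mathbb R\to\mathbb R\cup\{+\infty\}$ is proper, closed and convex with $\operatorname{dom}f_i\subset[0,1]$. Suppose moreover that for every $i$: - $f_i$ is essentially smooth: $C_i=\operatorname{int}(\operatorname{dom} f_i)$ is nonempty, $f_i$ is differentiable on $C_i$, and $|f_i'(x_k)|\to+\infty$ for every sequence $(x_k)$ in $C_i$ converging to a boundary point of $C_i$; - $f_i$ is twice differentiable on $C_i$ and $f_i''$ is locally Lipschitz on $C_i$; - $f_i$ is strongly convex on $\operatorname{dom}f_i$ with a parameter $\eta>0$ that does not depend on $i$ (so that $f_i''\ge\eta$ on $C_i$). If $N\ge2$, assume also that $\operatorname{dom}F$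 is not a single point. Let $F^*(\psi)=\sup_{w\in\mathbb R^N}\big(\langle\psi,w\rangle-F(w)\big)$ be the convex conjugate of $F$. Then $F^*$ is finite and twice differentiable on all of $\mathbb R^N$, and for every $\psi\in\mathbb R^N$ $$\ker D^2F^*(\psi)=\operatorname{span}\{\mathbb 1\},$$ where $\mathbb 1\in\mathbb R^N$ is the vector all of whose components are $1$. -/

import Mathlib

open Set Filter Topology

noncomputable section

namespace StorageFee

/-- The effective domain of an extended-real-valued function: the points where it is not `+∞`. -/
def effDom {E : Type*} (g : E → EReal) : Set E := {x | g x ≠ ⊤}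

/-- The real-valued function which agrees with `g` wherever `g` is finite. -/
def realPart {E : Type*} (g : E → EReal) : E → ℝ := fun x => (g x).toReal

/-- A proper closed convex function `E → ℝ ∪ {+∞}`: it never takes the value `-∞`, it is not
identically `+∞`, it is lower semicontinuous, and its epigraph is convex. -/
structure IsProperClosedConvex {E : Type*} [AddCommGroup E] [Module ℝ E] [TopologicalSpace E]
    (g : E → EReal) : Prop where
  ne_bot : ∀ x, g x ≠ ⊥
  nonempty_effDom : (effDom g).Nonempty
  closed : LowerSemicontinuous g
  convex : Convex ℝ {p : E × ℝ | g p.1 ≤ (p.2 : EReal)}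

/-- The set of admissible weight vectors (the unit simplex of `ℝ^N`). -/
def weightSet (N : ℕ) : Set (EuclideanSpace ℝ (Fin N)) :=
  {w | ∑ i, w i = 1 ∧ ∀ i, 0 ≤ w i}

open Classical in
/-- The convex-analysis indicator function of a set: `0` on `A` and `+∞` off `A`. -/
def indicatorFn {E : Type*} (A : Set E) : E → EReal := fun x => if x ∈ A then 0 else ⊤

/-- A storage fee function: proper, closed, convex and `+∞` outside of the simplex. -/
structure IsStorageFee {N : ℕ} (F : EuclideanSpace ℝ (Fin N) → EReal) : Prop where
  properClosedConvex : IsProperClosedConvex F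
  effDom_subset : effDom F ⊆ weightSet N

/-- `F` splits into the one-variable functions `f i`. -/
structure SplitsInto {N : ℕ} (F : EuclideanSpace ℝ (Fin N) → EReal) (f : Fin N → ℝ → EReal) :
    Prop where
  properClosedConvex : ∀ i, IsProperClosedConvex (f i)
  effDom_subset : ∀ i, effDom (f i) ⊆ Icc 0 1
  eq_sum : ∀ w, F w = ∑ i, f i (w i) + indicatorFn (weightSet N) w

/-- Essential smoothness of an extended-real-valued function `g` of one real variable: with
`C = interior (dom g)`, `C` is nonempty, `g` is differentiable on `C`, and `|g'(x k)| → +∞` for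
every sequence `x k` in `C` that converges to a boundary point of `C`. -/
structure IsEssentiallySmooth (g : ℝ → EReal) : Prop where
  nonempty : (interior (effDom g)).Nonempty
  differentiableOn : DifferentiableOn ℝ (realPart g) (interior (effDom g))
  tendsto_abs_deriv : ∀ x : ℕ → ℝ, (∀ k, x k ∈ interior (effDom g)) →
    ∀ z ∈ frontier (interior (effDom g)), Tendsto x atTop (𝓝 z) →
      Tendsto (fun k => |deriv (realPart g) (x k)|) atTop atTop

/-- The Legendre-Fenchel conjugate `g*(ψ) = sup_w (⟨ψ, w⟩ - g w)`. -/
def conjugate {E : Type*} [NormedAddCommGroup E] [InnerProductSpace ℝ E] (g : E → EReal) :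
    E → EReal :=
  fun ψ => ⨆ w : E, ((inner ℝ ψ w : ℝ) : EReal) - g w

/-- The Hessian `D²h(ψ)`, as the derivative of the gradient. -/
def hessian {N : ℕ} (h : EuclideanSpace ℝ (Fin N) → ℝ) (ψ : EuclideanSpace ℝ (Fin N)) :
    EuclideanSpace ℝ (Fin N) →L[ℝ] EuclideanSpace ℝ (Fin N) :=
  fderiv ℝ (gradient h) ψ

/-- The vector of `ℝ^N` all of whose components are `1`. -/
def oneVec (N : ℕ) : EuclideanSpace ℝ (Fin N) := WithLp.toLp 2 (fun _ => (1 : ℝ))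

end StorageFee

end

/-!
The derivative of each `f i` is a homeomorphism of `interior (dom (f i))` onto `ℝ`, with
differentiable inverse `r i`. By the Karush-Kuhn-Tucker conditions the supremum in `F* ψ` is
attained at `w ψ = (r i (ψ i - μ ψ))ᵢ`, where the Lagrange multiplier `μ ψ` is determined by
`∑ i, r i (ψ i - μ ψ) = 1`; such a multiplier exists because `∑ i, w i = 1` is solvable in the
product of the interiors as soon as `dom F` has two points. Then `w = ∇F*`. Differentiating the
constraint gives `Dμ 𝟙 = 1`, and the `i`-th component of `Dw v` is a positive multiple of
`v i - Dμ v`: it vanishes for all `i` exactly when `v` is constant.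
-/

namespace StorageFee

section ConvexConjugate

variable {E : Type*} [NormedAddCommGroup E] [InnerProductSpace ℝ E]

/-- `ψ` is a subgradient of `g` at `w`, a point of the effective domain. The affine minorant is
compared with `g` in `EReal`, which makes `g` avoid `-∞`. -/
structure IsSubgradientAt (g : E → EReal) (ψ w : E) : Prop where
  mem_effDom : w ∈ effDom g
  le : ∀ y, ((realPart g w + inner ℝ ψ (y - w) : ℝ) : EReal) ≤ g y

namespace IsSubgradientAt

variable {g : E → EReal} {φ ψ v w : E}

lemma coe_realPart (h : IsSubgradientAt g ψ w) : (realPart g w : EReal) = g w :=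
  EReal.coe_toReal h.mem_effDom fun hbot => by simpa [hbot] using h.le w

lemma conjugate_eq (h : IsSubgradientAt g ψ w) :
    conjugate g ψ = ((inner ℝ ψ w - realPart g w : ℝ) : EReal) := by
  refine le_antisymm (iSup_le fun y => ?_) (le_iSup_of_le w ?_)
  · calc (inner ℝ ψ y : EReal) - g y
        ≤ (inner ℝ ψ y : EReal) - ((realPart g w + inner ℝ ψ (y - w) : ℝ) : EReal) :=
          EReal.sub_le_sub le_rfl (h.le y)
      _ = ((inner ℝ ψ w - realPart g w : ℝ) : EReal) := by
          rw [← EReal.coe_sub, inner_sub_right]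
          congr 1
          ring
  · rw [EReal.coe_sub, h.coe_realPart]

lemma realPart_conjugate (h : IsSubgradientAt g ψ w) :
    realPart (conjugate g) ψ = inner ℝ ψ w - realPart g w := by
  rw [realPart, h.conjugate_eq, EReal.toReal_coe]

lemma inner_le_realPart_conjugate_sub (hw : IsSubgradientAt g ψ w) (hv : IsSubgradientAt g φ v) :
    inner ℝ w (φ - ψ) ≤ realPart (conjugate g) φ - realPart (conjugate g) ψ := by
  have hle : realPart g v + inner ℝ φ (w - v) ≤ realPart g w := by
    exact_mod_cast (hv.le w).trans_eq hw.coe_realPart.symm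
  rw [hw.realPart_conjugate, hv.realPart_conjugate, inner_sub_right, real_inner_comm φ,
    real_inner_comm ψ]
  rw [inner_sub_right] at hle
  linarith

end IsSubgradientAt

lemma hasGradientAt_of_inner_le_sub [CompleteSpace E] {h : E → ℝ} {s : E → E} {x : E}
    (hs : ContinuousAt s x) (hle : ∀ y z, inner ℝ (s y) (z - y) ≤ h z - h y) :
    HasGradientAt h (s x) x := by
  rw [hasGradientAt_iff_isLittleO, Asymptotics.isLittleO_iff]
  intro c hc
  filter_upwards [hs.eventually (Metric.closedBall_mem_nhds (s x) hc)] with y hy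
  rw [dist_eq_norm] at hy
  have lower : 0 ≤ h y - h x - inner ℝ (s x) (y - x) := sub_nonneg.2 (hle x y)
  have upper : h y - h x ≤ inner ℝ (s y) (y - x) := by
    have := hle y x
    rw [← neg_sub y x, inner_neg_right] at this
    linarith
  rw [Real.norm_of_nonneg lower]
  calc h y - h x - inner ℝ (s x) (y - x) ≤ inner ℝ (s y - s x) (y - x) := by
        rw [inner_sub_left]
        linarith
    _ ≤ ‖s y - s x‖ * ‖y - x‖ := real_inner_le_norm _ _
    _ ≤ c * ‖y - x‖ := by gcongr

lemma hasGradientAt_realPart_conjugate [CompleteSpace E] {g : E → EReal} {w : E → E} {ψ : E}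
    (hcont : ContinuousAt w ψ) (hw : ∀ φ, IsSubgradientAt g φ (w φ)) :
    HasGradientAt (realPart (conjugate g)) (w ψ) ψ :=
  hasGradientAt_of_inner_le_sub hcont fun φ χ =>
    (hw φ).inner_le_realPart_conjugate_sub (hw χ)

lemma isSubgradientAt_of_effDom_eq_singleton {g : E → EReal} (hbot : ∀ x, g x ≠ ⊥) {w : E}
    (hg : effDom g = {w}) (ψ : E) : IsSubgradientAt g ψ w where
  mem_effDom := hg ▸ mem_singleton w
  le y := by
    by_cases hy : y ∈ effDom g
    · obtain rfl : y = w := by rwa [hg] at hy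
      rw [sub_self, inner_zero_right, add_zero, realPart, EReal.coe_toReal hy (hbot y)]
    · rw [not_not.1 hy]
      exact le_top

end ConvexConjugate

lemma IsProperClosedConvex.convexOn_realPart {E : Type*} [AddCommGroup E] [Module ℝ E]
    [TopologicalSpace E] {g : E → EReal} (hg : IsProperClosedConvex g) :
    ConvexOn ℝ (effDom g) (realPart g) := by
  have coe_realPart : ∀ {x}, x ∈ effDom g → (realPart g x : EReal) = g x := fun hx =>
    EReal.coe_toReal hx (hg.ne_bot _)
  have le_combo : ∀ ⦃x⦄, x ∈ effDom g → ∀ ⦃y⦄, y ∈ effDom g → ∀ ⦃a b : ℝ⦄, 0 ≤ a → 0 ≤ b →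
      a + b = 1 → g (a • x + b • y) ≤ ((a • realPart g x + b • realPart g y : ℝ) : EReal) :=
    fun x hx y hy a b ha hb hab =>
      hg.convex (x := (x, realPart g x)) (coe_realPart hx).ge (y := (y, realPart g y))
        (coe_realPart hy).ge ha hb hab
  have convex : Convex ℝ (effDom g) := fun x hx y hy a b ha hb hab =>
    ((le_combo hx hy ha hb hab).trans_lt (EReal.coe_lt_top _)).ne
  refine ⟨convex, fun x hx y hy a b ha hb hab => ?_⟩
  rw [← EReal.coe_le_coe_iff, coe_realPart (convex hx hy ha hb hab)]
  exact le_combo hx hy ha hb hab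

section RealFunctions

lemma tangent_le_of_convexOn {s : Set ℝ} {f : ℝ → ℝ} (hf : ConvexOn ℝ s f) {x y : ℝ}
    (hx : x ∈ s) (hy : y ∈ s) (hd : DifferentiableAt ℝ f x) :
    f x + deriv f x * (y - x) ≤ f y := by
  rcases lt_trichotomy x y with h | rfl | h
  · have := hf.deriv_le_slope hx hy h hd
    rw [slope_def_field, le_div_iff₀ (sub_pos.2 h)] at this
    linarith
  · simp
  · have := hf.slope_le_deriv hy hx h hd
    rw [slope_def_field, div_le_iff₀ (sub_pos.2 h)] at this
    linarith

lemma le_deriv_deriv_of_strongConvexOn {s : Set ℝ} {f : ℝ → ℝ} {η x : ℝ}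
    (hf : StrongConvexOn s η f) (hd : DifferentiableOn ℝ f (interior s)) (hx : x ∈ interior s)
    (hd' : DifferentiableAt ℝ (deriv f) x) : η ≤ deriv (deriv f) x := by
  have hconv : ConvexOn ℝ (interior s) fun y => f y - η / 2 * ‖y‖ ^ 2 :=
    (strongConvexOn_iff_convex.1 hf).subset interior_subset hf.1.interior
  have hderiv : ∀ y ∈ interior s,
      HasDerivAt (fun y => f y - η / 2 * ‖y‖ ^ 2) (deriv f y - η * y) y := by
    intro y hy
    have hsq : HasDerivAt (fun y : ℝ => η / 2 * ‖y‖ ^ 2) (η * y) y := by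
      simp only [Real.norm_eq_abs, sq_abs]
      refine ((hasDerivAt_pow 2 y).const_mul (η / 2)).congr_deriv ?_
      push_cast
      ring
    exact (hd.differentiableAt (isOpen_interior.mem_nhds hy)).hasDerivAt.sub hsq
  have hmono : MonotoneOn (fun y => deriv f y - η * y) (interior s) :=
    (hconv.monotoneOn_deriv fun y hy => (hderiv y hy).differentiableAt).congr
      fun y hy => (hderiv y hy).deriv
  have hsecond : HasDerivAt (fun y => deriv f y - η * y) (deriv (deriv f) x - η) x := by
    exact (hd'.hasDerivAt.sub ((hasDerivAt_id x).const_mul η)).congr_deriv (by rw [mul_one])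
  have := hmono.derivWithin_nonneg (x := x)
  rw [derivWithin_of_mem_nhds (isOpen_interior.mem_nhds hx), hsecond.deriv] at this
  linarith

lemma eq_Ioo_csInf_csSup {s : Set ℝ} (ho : IsOpen s) (hc : IsConnected s)
    (hb : Bornology.IsBounded s) : s = Ioo (sInf s) (sSup s) := by
  refine Subset.antisymm ?_ (hc.Ioo_csInf_csSup_subset hb.bddBelow hb.bddAbove)
  rw [← interior_Icc]
  exact ho.subset_interior_iff.2 (subset_Icc_csInf_csSup hb.bddBelow hb.bddAbove)

lemma tendsto_atTop_of_tendsto_abs_atTop {α : Type*} {l : Filter α} {u : α → ℝ} {c : ℝ}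
    (hu : Tendsto (fun x => |u x|) l atTop) (hc : ∀ᶠ x in l, c ≤ u x) : Tendsto u l atTop := by
  refine tendsto_atTop.2 fun t => ?_
  filter_upwards [hu.eventually_gt_atTop (max |c| |t|), hc] with x hx hcx
  by_contra! hxt
  exact hx.not_ge (abs_le_max_abs_abs hcx hxt.le)

lemma tendsto_atBot_of_tendsto_abs_atTop {α : Type*} {l : Filter α} {u : α → ℝ} {c : ℝ}
    (hu : Tendsto (fun x => |u x|) l atTop) (hc : ∀ᶠ x in l, u x ≤ c) : Tendsto u l atBot :=
  tendsto_neg_atTop_iff.1 <| tendsto_atTop_of_tendsto_abs_atTop (by simpa only [abs_neg] using hu)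
    (hc.mono fun _ => neg_le_neg)

lemma surjOn_univ_of_tendsto_abs_frontier {s : Set ℝ} (ho : IsOpen s) (hc : IsConnected s)
    (hb : Bornology.IsBounded s) {u : ℝ → ℝ} (hcont : ContinuousOn u s) (hmono : MonotoneOn u s)
    (hu : ∀ z ∈ frontier s, Tendsto (fun x => |u x|) (𝓝[s] z) atTop) : SurjOn u s univ := by
  obtain ⟨m, hm⟩ := hc.nonempty
  obtain ⟨a, b, rfl⟩ : ∃ a b, s = Ioo a b := ⟨_, _, eq_Ioo_csInf_csSup ho hc hb⟩
  have hab : a < b := nonempty_Ioo.1 ⟨m, hm⟩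
  rw [frontier_Ioo hab] at hu
  have hleft : Tendsto (fun x => |u x|) (𝓝[>] a) atTop :=
    nhdsWithin_Ioo_eq_nhdsGT hab ▸ hu a (mem_insert a {b})
  have hright : Tendsto (fun x => |u x|) (𝓝[<] b) atTop :=
    nhdsWithin_Ioo_eq_nhdsLT hab ▸ hu b (mem_insert_of_mem a rfl)
  refine hcont.surjOn_of_tendsto ⟨m, hm⟩ ?_ ?_
  · refine (tendsto_comp_coe_Ioo_atBot hab).2
      (tendsto_atBot_of_tendsto_abs_atTop hleft (c := u m) ?_)
    filter_upwards [Ioo_mem_nhdsGT hm.1] with x hx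
    exact hmono ⟨hx.1, hx.2.trans hm.2⟩ hm hx.2.le
  · refine (tendsto_comp_coe_Ioo_atTop hab).2
      (tendsto_atTop_of_tendsto_abs_atTop hright (c := u m) ?_)
    filter_upwards [Ioo_mem_nhdsLT hm.2] with x hx
    exact hmono hm ⟨hm.1.trans hx.1, hx.2⟩ hx.1.le

end RealFunctions

section LegendreFunctions

variable {g : ℝ → EReal}

lemma IsEssentiallySmooth.tendsto_abs_deriv_nhdsWithin (hg : IsEssentiallySmooth g) {z : ℝ}
    (hz : z ∈ frontier (interior (effDom g))) :
    Tendsto (fun x => |deriv (realPart g) x|) (𝓝[interior (effDom g)] z) atTop := by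
  refine tendsto_of_seq_tendsto fun x hx => ?_
  obtain ⟨hxz, hmem⟩ := tendsto_nhdsWithin_iff.1 hx
  obtain ⟨n, hn⟩ := eventually_atTop.1 hmem
  exact (tendsto_add_atTop_iff_nat n).1 <| hg.tendsto_abs_deriv (fun k => x (k + n))
    (fun k => hn _ (Nat.le_add_left n k)) z hz ((tendsto_add_atTop_iff_nat n).2 hxz)

/-- Convex functions of Legendre type on a bounded interval, with positive second derivative inside
it. As `deriv` vanishes wherever the derivative does not exist, `deriv_deriv_pos` also says that
the function is twice differentiable there. -/
structure IsCurvedLegendre (g : ℝ → EReal) : Prop where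
  properClosedConvex : IsProperClosedConvex g
  isBounded_effDom : Bornology.IsBounded (effDom g)
  essentiallySmooth : IsEssentiallySmooth g
  deriv_deriv_pos : ∀ x ∈ interior (effDom g), 0 < deriv (deriv (realPart g)) x

/-- The inverse of `g'` on the interior of the effective domain, that is, the derivative of the
conjugate of `g`. -/
noncomputable def derivInv (g : ℝ → EReal) : ℝ → ℝ :=
  Function.invFunOn (deriv (realPart g)) (interior (effDom g))

namespace IsCurvedLegendre

lemma convex_effDom (hg : IsCurvedLegendre g) : Convex ℝ (effDom g) :=
  hg.properClosedConvex.convexOn_realPart.1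

lemma hasDerivAt_deriv (hg : IsCurvedLegendre g) {x : ℝ} (hx : x ∈ interior (effDom g)) :
    HasDerivAt (deriv (realPart g)) (deriv (deriv (realPart g)) x) x :=
  (differentiableAt_of_deriv_ne_zero (hg.deriv_deriv_pos x hx).ne').hasDerivAt

lemma continuousOn_deriv (hg : IsCurvedLegendre g) :
    ContinuousOn (deriv (realPart g)) (interior (effDom g)) := fun _ hx =>
  (hg.hasDerivAt_deriv hx).continuousAt.continuousWithinAt

lemma strictMonoOn_deriv (hg : IsCurvedLegendre g) :
    StrictMonoOn (deriv (realPart g)) (interior (effDom g)) :=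
  strictMonoOn_of_deriv_pos hg.convex_effDom.interior hg.continuousOn_deriv fun x hx =>
    hg.deriv_deriv_pos x (interior_subset hx)

lemma isConnected_interior_effDom (hg : IsCurvedLegendre g) :
    IsConnected (interior (effDom g)) :=
  ⟨hg.essentiallySmooth.nonempty, hg.convex_effDom.interior.isPreconnected⟩

lemma isBounded_interior_effDom (hg : IsCurvedLegendre g) :
    Bornology.IsBounded (interior (effDom g)) :=
  hg.isBounded_effDom.subset interior_subset

lemma interior_effDom_eq_Ioo (hg : IsCurvedLegendre g) : interior (effDom g) =
    Ioo (sInf (interior (effDom g))) (sSup (interior (effDom g))) :=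
  eq_Ioo_csInf_csSup isOpen_interior hg.isConnected_interior_effDom hg.isBounded_interior_effDom

lemma csInf_lt_csSup (hg : IsCurvedLegendre g) :
    sInf (interior (effDom g)) < sSup (interior (effDom g)) :=
  nonempty_Ioo.1 (hg.interior_effDom_eq_Ioo ▸ hg.essentiallySmooth.nonempty)

lemma effDom_subset_Icc (hg : IsCurvedLegendre g) :
    effDom g ⊆ Icc (sInf (interior (effDom g))) (sSup (interior (effDom g))) :=
  calc effDom g ⊆ closure (effDom g) := subset_closure
    _ = closure (interior (effDom g)) :=
      (hg.convex_effDom.closure_interior_eq_closure_of_nonempty_interior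
        hg.essentiallySmooth.nonempty).symm
    _ = closure (Ioo _ _) := by rw [← hg.interior_effDom_eq_Ioo]
    _ = Icc _ _ := closure_Ioo hg.csInf_lt_csSup.ne

lemma surjOn_deriv (hg : IsCurvedLegendre g) :
    SurjOn (deriv (realPart g)) (interior (effDom g)) univ :=
  surjOn_univ_of_tendsto_abs_frontier isOpen_interior hg.isConnected_interior_effDom
    hg.isBounded_interior_effDom hg.continuousOn_deriv hg.strictMonoOn_deriv.monotoneOn
    fun _ => hg.essentiallySmooth.tendsto_abs_deriv_nhdsWithin

lemma derivInv_mem (hg : IsCurvedLegendre g) (t : ℝ) : derivInv g t ∈ interior (effDom g) :=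
  Function.invFunOn_mem (hg.surjOn_deriv (mem_univ t))

lemma deriv_derivInv (hg : IsCurvedLegendre g) (t : ℝ) :
    deriv (realPart g) (derivInv g t) = t :=
  Function.invFunOn_eq (hg.surjOn_deriv (mem_univ t))

lemma derivInv_deriv (hg : IsCurvedLegendre g) {x : ℝ} (hx : x ∈ interior (effDom g)) :
    derivInv g (deriv (realPart g) x) = x :=
  hg.strictMonoOn_deriv.injOn (hg.derivInv_mem _) hx (hg.deriv_derivInv _)

lemma range_derivInv (hg : IsCurvedLegendre g) : range (derivInv g) = interior (effDom g) :=
  Subset.antisymm (range_subset_iff.2 hg.derivInv_mem) fun _ hx => ⟨_, hg.derivInv_deriv hx⟩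

lemma strictMono_derivInv (hg : IsCurvedLegendre g) : StrictMono (derivInv g) := fun s t hst => by
  rwa [← hg.strictMonoOn_deriv.lt_iff_lt (hg.derivInv_mem s) (hg.derivInv_mem t),
    hg.deriv_derivInv, hg.deriv_derivInv]

lemma continuous_derivInv (hg : IsCurvedLegendre g) : Continuous (derivInv g) :=
  continuous_iff_continuousAt.2 fun t =>
    (hg.strictMono_derivInv.strictMonoOn univ).continuousAt_of_image_mem_nhds univ_mem <| by
      rw [image_univ, hg.range_derivInv]
      exact isOpen_interior.mem_nhds (hg.derivInv_mem t)

lemma hasDerivAt_derivInv (hg : IsCurvedLegendre g) (t : ℝ) :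
    HasDerivAt (derivInv g) (deriv (deriv (realPart g)) (derivInv g t))⁻¹ t :=
  (hg.hasDerivAt_deriv (hg.derivInv_mem t)).of_local_left_inverse
    hg.continuous_derivInv.continuousAt (hg.deriv_deriv_pos _ (hg.derivInv_mem t)).ne'
    (Eventually.of_forall hg.deriv_derivInv)

lemma deriv_derivInv_pos (hg : IsCurvedLegendre g) (t : ℝ) : 0 < deriv (derivInv g) t := by
  rw [(hg.hasDerivAt_derivInv t).deriv]
  exact inv_pos.2 (hg.deriv_deriv_pos _ (hg.derivInv_mem t))

lemma isSubgradientAt_derivInv (hg : IsCurvedLegendre g) (t : ℝ) :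
    IsSubgradientAt g t (derivInv g t) where
  mem_effDom := interior_subset (hg.derivInv_mem t)
  le y := by
    by_cases hy : y ∈ effDom g
    · have htangent := tangent_le_of_convexOn hg.properClosedConvex.convexOn_realPart
        (interior_subset (hg.derivInv_mem t)) hy
        (hg.essentiallySmooth.differentiableOn.differentiableAt
          (isOpen_interior.mem_nhds (hg.derivInv_mem t)))
      rw [hg.deriv_derivInv, mul_comm] at htangent
      rw [← EReal.coe_toReal hy (hg.properClosedConvex.ne_bot y)]
      exact EReal.coe_le_coe_iff.2 htangent
    · rw [not_not.1 hy]
      exact le_top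

end IsCurvedLegendre

end LegendreFunctions

section ImplicitFunctions

/-- Pointwise implicit differentiation: continuity of the implicit function `μ` replaces the strict
differentiability of `G` that the implicit function theorem would need. -/
lemma hasFDerivAt_of_apply_eq_const {E : Type*} [NormedAddCommGroup E] [NormedSpace ℝ E]
    {G : E × ℝ → ℝ} {A : E →L[ℝ] ℝ} {b c : ℝ} {μ : E → ℝ} {x : E} (hb : b ≠ 0)
    (hμ : ContinuousAt μ x)
    (hG : HasFDerivAt G (A.coprod (b • ContinuousLinearMap.id ℝ ℝ)) (x, μ x))
    (hc : ∀ y, G (y, μ y) = c) : HasFDerivAt μ (-(b⁻¹ • A)) x := by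
  have hgraph := (hasFDerivAt_fst.prodMk hG).of_comp_of_leftInverse (g := fun y => (y, μ y))
    (f'symm := (ContinuousLinearMap.fst ℝ E ℝ).prod
      (b⁻¹ • (ContinuousLinearMap.snd ℝ E ℝ - A ∘L ContinuousLinearMap.fst ℝ E ℝ)))
    (continuousAt_id.prodMk hμ) ((hasFDerivAt_id x).prodMk (hasFDerivAt_const c x))
    (Eventually.of_forall fun y => Prod.ext rfl (hc y)) fun p => by ext <;> simp [hb]
  refine hgraph.snd.congr_fderiv ?_
  ext v
  simp

lemma continuous_of_strictAnti_apply_eq_const {X : Type*} [TopologicalSpace X] {G : X → ℝ → ℝ}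
    {c : ℝ} {μ : X → ℝ} (hG : ∀ m, Continuous fun x => G x m) (hanti : ∀ x, StrictAnti (G x))
    (hc : ∀ x, G x (μ x) = c) : Continuous μ := by
  refine continuous_iff_continuousAt.2 fun x => tendsto_order.2 ⟨fun m hm => ?_, fun m hm => ?_⟩
  · have hlt : c < G x m := hc x ▸ hanti x hm
    filter_upwards [(hG m).continuousAt.eventually_const_lt hlt] with y hy
    exact (hanti y).lt_iff_gt.1 (by rwa [hc])
  · have hlt : G x m < c := hc x ▸ hanti x hm
    filter_upwards [(hG m).continuousAt.eventually_lt_const hlt] with y hy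
    exact (hanti y).lt_iff_gt.1 (by rwa [hc])

end ImplicitFunctions

section ShiftedDiagonal

variable {ι : Type*}

/-- The linear map `v ↦ (d i * (v i - L v))ᵢ`, the shape of the derivative of
`ψ ↦ (r i (ψ i - μ ψ))ᵢ`. -/
noncomputable def shiftedDiagonal (d : ι → ℝ) (L : EuclideanSpace ℝ ι →L[ℝ] ℝ) :
    EuclideanSpace ℝ ι →L[ℝ] EuclideanSpace ℝ ι :=
  (EuclideanSpace.equiv ι ℝ).symm.toContinuousLinearMap ∘L
    ContinuousLinearMap.pi fun i => d i • (EuclideanSpace.proj i - L)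

lemma shiftedDiagonal_apply (d : ι → ℝ) (L : EuclideanSpace ℝ ι →L[ℝ] ℝ)
    (v : EuclideanSpace ℝ ι) (i : ι) : shiftedDiagonal d L v i = d i * (v i - L v) := rfl

lemma ker_shiftedDiagonal {d : ι → ℝ} {L : EuclideanSpace ℝ ι →L[ℝ] ℝ} (hd : ∀ i, d i ≠ 0)
    (hL : L (WithLp.toLp 2 fun _ => 1) = 1) :
    (shiftedDiagonal d L).toLinearMap.ker = Submodule.span ℝ {WithLp.toLp 2 fun _ => 1} := by
  ext v
  rw [LinearMap.mem_ker, Submodule.mem_span_singleton, ContinuousLinearMap.coe_coe]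
  constructor
  · intro hv
    refine ⟨L v, PiLp.ext fun i => ?_⟩
    have hi : d i * (v i - L v) = 0 := by rw [← shiftedDiagonal_apply, hv, PiLp.zero_apply]
    simpa using (sub_eq_zero.1 ((mul_eq_zero.1 hi).resolve_left (hd i))).symm
  · rintro ⟨s, rfl⟩
    ext i
    simp [shiftedDiagonal_apply, hL]

end ShiftedDiagonal

section Multiplier

variable {ι : Type*} [Fintype ι] {r : ι → ℝ → ℝ}

lemma exists_sum_sub_eq (hmono : ∀ i, Monotone (r i)) (hcont : ∀ i, Continuous (r i))
    (s x : ι → ℝ) : ∃ m : ℝ, ∑ i, r i (x i - m) = ∑ i, r i (s i) := by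
  have hle : ∀ i, |x i - s i| ≤ ∑ j, |x j - s j| := fun i =>
    Finset.single_le_sum (f := fun j => |x j - s j|) (fun j _ => abs_nonneg _) (Finset.mem_univ i)
  refine mem_range_of_exists_le_of_exists_ge (f := fun m => ∑ i, r i (x i - m))
    (by fun_prop)
    ⟨∑ j, |x j - s j|, Finset.sum_le_sum fun i _ => hmono i ?_⟩
    ⟨-∑ j, |x j - s j|, Finset.sum_le_sum fun i _ => hmono i ?_⟩
  · linarith [(abs_le.1 (hle i)).2]
  · linarith [(abs_le.1 (hle i)).1]

variable {μ : EuclideanSpace ℝ ι → ℝ} {c : ℝ}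

lemma continuous_of_sum_sub_eq [Nonempty ι] (hmono : ∀ i, StrictMono (r i))
    (hcont : ∀ i, Continuous (r i)) (hμ : ∀ ψ, ∑ i, r i (ψ i - μ ψ) = c) : Continuous μ :=
  continuous_of_strictAnti_apply_eq_const (G := fun ψ m => ∑ i, r i (ψ i - m))
    (fun m => by fun_prop)
    (fun ψ m m' h => Finset.sum_lt_sum_of_nonempty Finset.univ_nonempty fun i _ =>
      hmono i (sub_lt_sub_left h _)) hμ

lemma hasFDerivAt_of_sum_sub_eq [Nonempty ι] (hr : ∀ i t, 0 < deriv (r i) t)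
    (hμ : ∀ ψ, ∑ i, r i (ψ i - μ ψ) = c) (ψ : EuclideanSpace ℝ ι) :
    HasFDerivAt μ ((∑ i, deriv (r i) (ψ i - μ ψ))⁻¹ •
      ∑ i, deriv (r i) (ψ i - μ ψ) • EuclideanSpace.proj (𝕜 := ℝ) i) ψ := by
  set d : ι → ℝ := fun i => deriv (r i) (ψ i - μ ψ)
  have hdiff : ∀ i, Differentiable ℝ (r i) := fun i t =>
    differentiableAt_of_deriv_ne_zero (hr i t).ne'
  have hd : 0 < ∑ i, d i := Finset.sum_pos (fun i _ => hr i _) Finset.univ_nonempty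
  have hG : HasFDerivAt (fun p : EuclideanSpace ℝ ι × ℝ => ∑ i, r i (p.1 i - p.2))
      ((∑ i, d i • EuclideanSpace.proj (𝕜 := ℝ) i).coprod
        ((-∑ i, d i) • ContinuousLinearMap.id ℝ ℝ)) (ψ, μ ψ) := by
    have hterm : ∀ i, HasFDerivAt (fun p : EuclideanSpace ℝ ι × ℝ => r i (p.1 i - p.2))
        (d i • (EuclideanSpace.proj (𝕜 := ℝ) i ∘L ContinuousLinearMap.fst ℝ _ ℝ -
          ContinuousLinearMap.snd ℝ _ ℝ)) (ψ, μ ψ) := fun i =>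
      (hdiff i _).hasDerivAt.comp_hasFDerivAt (ψ, μ ψ)
        (((EuclideanSpace.proj (𝕜 := ℝ) i).hasFDerivAt.comp _ hasFDerivAt_fst).sub
          hasFDerivAt_snd)
    refine (HasFDerivAt.fun_sum fun i _ => hterm i).congr_fderiv ?_
    ext <;> simp
  have hcont : Continuous μ := continuous_of_sum_sub_eq
    (fun i => strictMono_of_deriv_pos (hr i)) (fun i => (hdiff i).continuous) hμ
  refine (hasFDerivAt_of_apply_eq_const (neg_ne_zero.2 hd.ne') hcont.continuousAt hG
    hμ).congr_fderiv ?_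
  ext v
  simp [d, inv_neg]

lemma exists_hasFDerivAt_ker_eq_span [Nonempty ι] (hr : ∀ i t, 0 < deriv (r i) t)
    (hμ : ∀ ψ, ∑ i, r i (ψ i - μ ψ) = c) (ψ : EuclideanSpace ℝ ι) :
    ∃ A : EuclideanSpace ℝ ι →L[ℝ] EuclideanSpace ℝ ι,
      HasFDerivAt (fun φ => WithLp.toLp 2 fun i => r i (φ i - μ φ)) A ψ ∧
      A.toLinearMap.ker = Submodule.span ℝ {WithLp.toLp 2 fun _ => 1} := by
  obtain ⟨L, hμL, hL⟩ : ∃ L, HasFDerivAt μ L ψ ∧ L (WithLp.toLp 2 fun _ => 1) = 1 := by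
    have hd : ∑ i, deriv (r i) (ψ i - μ ψ) ≠ 0 :=
      (Finset.sum_pos (fun i _ => hr i _) Finset.univ_nonempty).ne'
    exact ⟨_, hasFDerivAt_of_sum_sub_eq hr hμ ψ, by simp [hd]⟩
  refine ⟨shiftedDiagonal (fun i => deriv (r i) (ψ i - μ ψ)) L, ?_,
    ker_shiftedDiagonal (fun i => (hr i _).ne') hL⟩
  rw [← hasFDerivWithinAt_univ, hasFDerivWithinAt_euclidean]
  intro i
  exact ((differentiableAt_of_deriv_ne_zero (hr i _).ne').hasDerivAt.comp_hasFDerivAt ψ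
    ((EuclideanSpace.proj (𝕜 := ℝ) i).hasFDerivAt.sub hμL)).hasFDerivWithinAt

end Multiplier

section Box

variable {ι : Type*} [Fintype ι] {a b u v : ι → ℝ}

lemma sum_lt_sum_of_le_of_ne (hu : a ≤ u) (hv : a ≤ v) (hsum : ∑ i, u i = ∑ i, v i)
    (huv : u ≠ v) : ∑ i, a i < ∑ i, u i := by
  rcases hu.eq_or_lt with rfl | hlt
  · exact (Fintype.sum_strictMono (hv.lt_of_ne huv)).trans_eq hsum.symm
  · exact Fintype.sum_strictMono hlt

lemma exists_mem_Ioo_sum_eq (hab : ∀ i, a i < b i) {c : ℝ} (ha : ∑ i, a i < c)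
    (hb : c < ∑ i, b i) : ∃ p : ι → ℝ, (∀ i, p i ∈ Ioo (a i) (b i)) ∧ ∑ i, p i = c := by
  have hlt : 0 < ∑ i, b i - ∑ i, a i := sub_pos.2 (ha.trans hb)
  set θ : ℝ := (c - ∑ i, a i) / (∑ i, b i - ∑ i, a i) with hθ
  have hθ0 : 0 < θ := div_pos (sub_pos.2 ha) hlt
  have hθ1 : θ < 1 := (div_lt_one hlt).2 (sub_lt_sub_right hb _)
  refine ⟨fun i => a i + θ * (b i - a i), fun i => ⟨?_, ?_⟩, ?_⟩
  · linarith [mul_pos hθ0 (sub_pos.2 (hab i))]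
  · linarith [mul_lt_of_lt_one_left (sub_pos.2 (hab i)) hθ1]
  · rw [Finset.sum_add_distrib, ← Finset.mul_sum, Finset.sum_sub_distrib, hθ,
      div_mul_cancel₀ _ hlt.ne', add_sub_cancel]

lemma exists_mem_Ioo_sum_eq_of_ne (hab : ∀ i, a i < b i) (hu : ∀ i, u i ∈ Icc (a i) (b i))
    (hv : ∀ i, v i ∈ Icc (a i) (b i)) (hsum : ∑ i, u i = ∑ i, v i) (huv : u ≠ v) :
    ∃ p : ι → ℝ, (∀ i, p i ∈ Ioo (a i) (b i)) ∧ ∑ i, p i = ∑ i, u i := by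
  refine exists_mem_Ioo_sum_eq hab
    (sum_lt_sum_of_le_of_ne (fun i => (hu i).1) (fun i => (hv i).1) hsum huv) ?_
  simpa using sum_lt_sum_of_le_of_ne (a := -b) (u := -u) (v := -v)
    (fun i => neg_le_neg (hu i).2) (fun i => neg_le_neg (hv i).2) (by simpa using hsum)
    (neg_injective.ne huv)

end Box

section Splitting

variable {ι : Type*} {x : ι → EReal}

lemma sum_ne_bot (s : Finset ι) (hx : ∀ i, x i ≠ ⊥) : ∑ i ∈ s, x i ≠ ⊥ :=
  Finset.sum_induction x (· ≠ ⊥) (fun _ _ ha hb => EReal.add_ne_bot_iff.2 ⟨ha, hb⟩)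
    EReal.zero_ne_bot fun i _ => hx i

lemma coe_sum (s : Finset ι) (x : ι → ℝ) : ((∑ i ∈ s, x i : ℝ) : EReal) = ∑ i ∈ s, (x i : EReal) :=
  map_sum (⟨⟨Real.toEReal, EReal.coe_zero⟩, EReal.coe_add⟩ : ℝ →+ EReal) x s

lemma sum_inner_sub_const [Fintype ι] {ψ v : EuclideanSpace ℝ ι} (hv : ∑ i, v i = 0) (m : ℝ) :
    ∑ i, inner ℝ (ψ i - m) (v i) = inner ℝ ψ v := by
  have hm : ∑ i, inner ℝ m (v i) = 0 := by rw [← inner_sum, hv, inner_zero_right]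
  simp only [inner_sub_left, Finset.sum_sub_distrib, hm, sub_zero, PiLp.inner_apply]

variable {N : ℕ} {F : EuclideanSpace ℝ (Fin N) → EReal} {f : Fin N → ℝ → EReal}

namespace SplitsInto

lemma apply_of_mem (h : SplitsInto F f) {w : EuclideanSpace ℝ (Fin N)} (hw : w ∈ weightSet N) :
    F w = ∑ i, f i (w i) := by
  rw [h.eq_sum, indicatorFn, if_pos hw, add_zero]

lemma sum_apply_ne_bot (h : SplitsInto F f) (w : EuclideanSpace ℝ (Fin N)) :
    ∑ i, f i (w i) ≠ ⊥ :=
  sum_ne_bot _ fun i => (h.properClosedConvex i).ne_bot (w i)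

lemma apply_of_notMem (h : SplitsInto F f) {w : EuclideanSpace ℝ (Fin N)}
    (hw : w ∉ weightSet N) : F w = ⊤ := by
  rw [h.eq_sum, indicatorFn, if_neg hw, EReal.add_top_of_ne_bot (h.sum_apply_ne_bot w)]

lemma apply_ne_bot (h : SplitsInto F f) (w : EuclideanSpace ℝ (Fin N)) : F w ≠ ⊥ := by
  by_cases hw : w ∈ weightSet N
  · exact h.apply_of_mem hw ▸ h.sum_apply_ne_bot w
  · exact h.apply_of_notMem hw ▸ bot_ne_top.symm

lemma effDom_subset_weightSet (h : SplitsInto F f) : effDom F ⊆ weightSet N := fun _ hw =>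
  of_not_not fun hmem => hw (h.apply_of_notMem hmem)

lemma apply_mem_effDom (h : SplitsInto F f) {w : EuclideanSpace ℝ (Fin N)} (hw : w ∈ effDom F)
    (i : Fin N) : w i ∈ effDom (f i) := fun hi => hw <| by
  rw [h.apply_of_mem (h.effDom_subset_weightSet hw),
    ← Finset.add_sum_erase _ _ (Finset.mem_univ i), hi]
  exact EReal.top_add_of_ne_bot (sum_ne_bot _ fun j => (h.properClosedConvex j).ne_bot _)

/-- The Karush-Kuhn-Tucker conditions, with the multiplier `m` of the constraint `∑ i, w i = 1`,
are sufficient. -/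
lemma isSubgradientAt (h : SplitsInto F f) {ψ w : EuclideanSpace ℝ (Fin N)} {m : ℝ}
    (hw : w ∈ weightSet N) (hm : ∀ i, IsSubgradientAt (f i) (ψ i - m) (w i)) :
    IsSubgradientAt F ψ w := by
  have hFw : F w = ((∑ i, realPart (f i) (w i) : ℝ) : EReal) := by
    simp only [h.apply_of_mem hw, coe_sum, (hm _).coe_realPart]
  refine ⟨(hFw.trans_lt (EReal.coe_lt_top _)).ne, fun y => ?_⟩
  by_cases hy : y ∈ weightSet N
  · have hsum : ∑ i, (y - w) i = 0 := by
      simp only [PiLp.sub_apply, Finset.sum_sub_distrib, hy.1, hw.1, sub_self]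
    calc ((realPart F w + inner ℝ ψ (y - w) : ℝ) : EReal)
        = ((∑ i, (realPart (f i) (w i) + inner ℝ (ψ i - m) (y i - w i)) : ℝ) : EReal) := by
          rw [realPart, hFw, EReal.toReal_coe, ← sum_inner_sub_const hsum m,
            Finset.sum_add_distrib]
          rfl
      _ ≤ ∑ i, f i (y i) := by
          rw [coe_sum]
          exact Finset.sum_le_sum fun i _ => (hm i).le (y i)
      _ = F y := (h.apply_of_mem hy).symm
  · rw [h.apply_of_notMem hy]
    exact le_top

end SplitsInto

end Splitting

section GradientSelection

variable {N : ℕ} {F : EuclideanSpace ℝ (Fin N) → EReal} {f : Fin N → ℝ → EReal}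

lemma weightSet_zero : weightSet 0 = ∅ := by
  simp [weightSet]

lemma weightSet_one : weightSet 1 = {oneVec 1} := by
  ext w
  simp only [weightSet, Fin.sum_univ_one, Fin.forall_fin_one, mem_ofPred_eq, mem_singleton_iff]
  constructor
  · rintro ⟨hw, -⟩
    ext i
    rw [Subsingleton.elim i 0, hw]
    rfl
  · rintro rfl
    simp [oneVec]

lemma span_oneVec_one : Submodule.span ℝ {oneVec 1} = ⊤ := by
  refine eq_top_iff.2 fun v _ => Submodule.mem_span_singleton.2 ⟨v 0, ?_⟩
  ext i
  rw [Subsingleton.elim i 0]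
  simp [oneVec]

lemma SplitsInto.exists_sum_derivInv_sub_eq_one (h : SplitsInto F f)
    (hf : ∀ i, IsCurvedLegendre (f i)) (hF : (effDom F).Nontrivial)
    (ψ : EuclideanSpace ℝ (Fin N)) : ∃ m : ℝ, ∑ i, derivInv (f i) (ψ i - m) = 1 := by
  obtain ⟨u, hu, v, hv, huv⟩ := hF
  have hu1 : ∑ i, u i = 1 := (h.effDom_subset_weightSet hu).1
  have hv1 : ∑ i, v i = 1 := (h.effDom_subset_weightSet hv).1
  obtain ⟨p, hp, hpu⟩ := exists_mem_Ioo_sum_eq_of_ne (fun i => (hf i).csInf_lt_csSup)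
    (fun i => (hf i).effDom_subset_Icc (h.apply_mem_effDom hu i))
    (fun i => (hf i).effDom_subset_Icc (h.apply_mem_effDom hv i)) (hu1.trans hv1.symm)
    fun huv' => huv (PiLp.ext (congrFun huv'))
  have hrange : ∀ i, p i ∈ range (derivInv (f i)) := fun i => by
    rw [(hf i).range_derivInv, (hf i).interior_effDom_eq_Ioo]
    exact hp i
  choose s hs using hrange
  obtain ⟨m, hm⟩ := exists_sum_sub_eq (fun i => (hf i).strictMono_derivInv.monotone)
    (fun i => (hf i).continuous_derivInv) s ψ
  simp only [hs] at hm
  exact ⟨m, hm.trans (hpu.trans hu1)⟩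

lemma SplitsInto.exists_isSubgradientAt_hasFDerivAt_of_nontrivial (h : SplitsInto F f)
    (hf : ∀ i, IsCurvedLegendre (f i)) (hF : (effDom F).Nontrivial) :
    ∃ w : EuclideanSpace ℝ (Fin N) → EuclideanSpace ℝ (Fin N), (∀ ψ, IsSubgradientAt F ψ (w ψ)) ∧
      ∀ ψ, ∃ A : EuclideanSpace ℝ (Fin N) →L[ℝ] EuclideanSpace ℝ (Fin N),
        HasFDerivAt w A ψ ∧ A.toLinearMap.ker = Submodule.span ℝ {oneVec N} := by
  choose μ hμ using h.exists_sum_derivInv_sub_eq_one hf hF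
  have hN : Nonempty (Fin N) := by
    by_contra hN
    rw [not_nonempty_iff] at hN
    simpa using hμ 0
  refine ⟨fun ψ => WithLp.toLp 2 fun i => derivInv (f i) (ψ i - μ ψ),
    fun ψ => h.isSubgradientAt ⟨hμ ψ, fun i => ?_⟩ fun i => (hf i).isSubgradientAt_derivInv _,
    exists_hasFDerivAt_ker_eq_span (fun i => (hf i).deriv_derivInv_pos) hμ⟩
  exact (h.effDom_subset i (interior_subset ((hf i).derivInv_mem _))).1

lemma SplitsInto.exists_isSubgradientAt_hasFDerivAt (h : SplitsInto F f)
    (hf : ∀ i, IsCurvedLegendre (f i)) (hF : (effDom F).Nonempty)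
    (hpoint : 2 ≤ N → ¬ ∃ a, effDom F = {a}) :
    ∃ w : EuclideanSpace ℝ (Fin N) → EuclideanSpace ℝ (Fin N), (∀ ψ, IsSubgradientAt F ψ (w ψ)) ∧
      ∀ ψ, ∃ A : EuclideanSpace ℝ (Fin N) →L[ℝ] EuclideanSpace ℝ (Fin N),
        HasFDerivAt w A ψ ∧ A.toLinearMap.ker = Submodule.span ℝ {oneVec N} := by
  have hsub := h.effDom_subset_weightSet
  match N with
  | 0 =>
    rw [weightSet_zero] at hsub
    exact absurd hF (not_nonempty_iff_eq_empty.2 (subset_empty_iff.1 hsub))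
  | 1 =>
    rw [weightSet_one] at hsub
    refine ⟨fun _ => oneVec 1, isSubgradientAt_of_effDom_eq_singleton h.apply_ne_bot
      (hF.subset_singleton_iff.1 hsub), fun ψ => ⟨0, hasFDerivAt_const _ ψ, ?_⟩⟩
    rw [span_oneVec_one]
    exact LinearMap.ker_zero
  | n + 2 =>
    refine h.exists_isSubgradientAt_hasFDerivAt_of_nontrivial hf (not_subsingleton_iff.1 ?_)
    exact fun hss => hpoint (Nat.le_add_left 2 n) (exists_eq_singleton_iff_nonempty_subsingleton.2
      ⟨hF, hss⟩)

end GradientSelection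

end StorageFee

theorem mainTheorem10_general {N : ℕ} (F : EuclideanSpace ℝ (Fin N) → EReal)
    (f : Fin N → ℝ → EReal) (hF : (StorageFee.effDom F).Nonempty)
    (hsplit : StorageFee.SplitsInto F f) (hsmooth : ∀ i, StorageFee.IsEssentiallySmooth (f i))
    (hpos : ∀ i, ∀ x ∈ interior (StorageFee.effDom (f i)),
      0 < deriv (deriv (StorageFee.realPart (f i))) x)
    (hpoint : 2 ≤ N → ¬ ∃ a, StorageFee.effDom F = {a}) :
    (∀ ψ, StorageFee.conjugate F ψ ≠ ⊥ ∧ StorageFee.conjugate F ψ ≠ ⊤) ∧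
    Differentiable ℝ (StorageFee.realPart (StorageFee.conjugate F)) ∧
    Differentiable ℝ (gradient (StorageFee.realPart (StorageFee.conjugate F))) ∧
    ∀ ψ : EuclideanSpace ℝ (Fin N),
      (StorageFee.hessian (StorageFee.realPart (StorageFee.conjugate F)) ψ).toLinearMap.ker =
        Submodule.span ℝ {StorageFee.oneVec N} := by
  have hf : ∀ i, StorageFee.IsCurvedLegendre (f i) := fun i =>
    ⟨hsplit.properClosedConvex i, (Metric.isBounded_Icc 0 1).subset (hsplit.effDom_subset i),
      hsmooth i, hpos i⟩
  obtain ⟨w, hw, hderiv⟩ := hsplit.exists_isSubgradientAt_hasFDerivAt hf hF hpoint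
  choose A hA hker using hderiv
  have hgrad := fun ψ =>
    StorageFee.hasGradientAt_realPart_conjugate (hA ψ).continuousAt hw
  have hgrad_eq : gradient (StorageFee.realPart (StorageFee.conjugate F)) = w :=
    funext fun ψ => (hgrad ψ).gradient
  refine ⟨fun ψ => ?_, fun ψ => (hgrad ψ).differentiableAt, fun ψ => ?_, fun ψ => ?_⟩
  · rw [(hw ψ).conjugate_eq]
    exact ⟨EReal.coe_ne_bot _, EReal.coe_ne_top _⟩
  · rw [hgrad_eq]
    exact (hA ψ).differentiableAt
  · rw [StorageFee.hessian, hgrad_eq, (hA ψ).fderiv]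
    exact hker ψ

theorem mainTheorem10 {N : ℕ} (F : EuclideanSpace ℝ (Fin N) → EReal) (f : Fin N → ℝ → EReal)
    (hF : StorageFee.IsStorageFee F) (hsplit : StorageFee.SplitsInto F f)
    (hsmooth : ∀ i, StorageFee.IsEssentiallySmooth (f i))
    (htwice : ∀ i, DifferentiableOn ℝ (deriv (StorageFee.realPart (f i)))
      (interior (StorageFee.effDom (f i))))
    (hlip : ∀ i, LocallyLipschitzOn (interior (StorageFee.effDom (f i)))
      (deriv (deriv (StorageFee.realPart (f i)))))
    (η : ℝ) (hη : 0 < η)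
    (hstrong : ∀ i, StrongConvexOn (StorageFee.effDom (f i)) η (StorageFee.realPart (f i)))
    (hpoint : 2 ≤ N → ¬ ∃ a, StorageFee.effDom F = {a}) :
    (∀ ψ, StorageFee.conjugate F ψ ≠ ⊥ ∧ StorageFee.conjugate F ψ ≠ ⊤) ∧
    Differentiable ℝ (StorageFee.realPart (StorageFee.conjugate F)) ∧
    Differentiable ℝ (gradient (StorageFee.realPart (StorageFee.conjugate F))) ∧
    ∀ ψ : EuclideanSpace ℝ (Fin N),
      (StorageFee.hessian (StorageFee.realPart (StorageFee.conjugate F)) ψ).toLinearMap.ker =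
        Submodule.span ℝ {StorageFee.oneVec N} :=
  mainTheorem10_general F f hF.properClosedConvex.nonempty_effDom hsplit hsmooth
    (fun i _ hx => hη.trans_le <| StorageFee.le_deriv_deriv_of_strongConvexOn (hstrong i)
      (hsmooth i).differentiableOn hx ((htwice i).differentiableAt (isOpen_interior.mem_nhds hx)))
    hpoint
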